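/- **Lemma (Anonymity of FedPoP).** For every security parameter $\kappa$ let an instance of FedPoP be given by: a $(t,n)$-threshold signature scheme $(\mathsf{TSKeyGen},\mathsf{TSSign},\mathsf{TSSignAgg},\mathsf{TSVerify})$; any secure aggregation protocol $(\mathsf{SASetup},\mathsf{SAProtect},\mathsf{SAAggregate})$ and training algorithm; a hash function $\mathsf H$ on models; a group $\mathbb G$ of prime order $q$ with a binary encoding; and hash functions $\mathsf H_1$ (into $\mathbb G$) and $\mathsf H_2$ (into bit strings), which define $F_K(x)=\mathsf H_2(x,\mathsf H_1(x)^K)$ for $K\in\mathbb Z_q$. All string lengths are polynomial in $\kappa$, and $\mathsf H$, $\mathsf H_1$, $\mathsf H_2$, exponentiation and decoding (with membership test) in $\mathbb G$, and $\mathsf{TSVerify}$ are computed by circuits of polynomial size. In each round $l$, with fresh setup, keys $(\mathcal{VK},\{\mathsf{vk}_i,\mathsf{sk}_i\}_{i\in[n]})$ are generated and the clients $\mathcal C_o$ that are online in this round train on the current model parameters, which result from the previous rounds, and obtain the securely aggregated model $M$. The FL server aggregates the partial signatures on $M$ of a set $S\subseteq\mathcal C_o$ of $t$ clients to a signature $\sigma$,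 draws $K\leftarrow\mathbb Z_q$, sends $(\sigma,K)$ to every client in $\mathcal C_o$, and sends $(M,\mathcal{VK},R)$ with $R=F_K(\mathcal{VK})$ to the service provider $S_{sp}$. To prove participation, a client in $\mathcal C_o$ sends $\mathsf H(M)$; if $S_{sp}$, which serves a model $M'$, finds $\mathsf H(M)=\mathsf H(M')$, it draws $\rho\leftarrow\mathbb Z_q^*$ and sends $\alpha=\mathsf H_1(\mathcal{VK})^\rho$; if $\alpha\in\mathbb G$, the client replies with $(\sigma,\beta)$, $\beta=\alpha^K$; finally $S_{sp}$ outputs $1$ if $\mathsf{TSVerify}(\sigma,M',\mathcal{VK})$ accepts and $\mathsf H_2(\mathcal{VK},\beta^{1/\rho})=R$, and $0$ otherwise. The view of $S_{sp}$ consists of its input $(M',\mathcal{VK},R)$, its coins and all messages it receives from the prover. Assume that the threshold signature scheme is signer-indistinguishable: every non-uniform PPT adversary that is given $\mathcal{VK}$ and, adaptively, signatures on messages $m$ aggregated from authorized sets (of size $t$) of its choice, and at one moment submits $(m^\star,S_0,S_1)$ with authorized sets $S_0,S_1$ and receives a signature on $m^\star$ by $S_b$, has negligible advantage in guessing the hidden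 bit $b$. Then for any round $l$, any two honest clients $C_0,C_1\in\mathcal C_o$ of round $l$, and any two sets $S_0,S_1\subseteq\mathcal C_o$ of size $t$ (possibly equal; for example $S_0\ni C_0$ and $S_1\ni C_1$ that are otherwise identical), all of which may depend on $\kappa$, the following holds: 1. For an honest-but-curious $S_{sp}$, holding any model $M'$ that is a function of $M$ (for example $M'=M$), its view together with its output when the prover is $C_0$ and the signers are $S_0$ is computationally indistinguishable from the same when the prover is $C_1$ and the signers are $S_1$. 2. The same holds for the view of any non-uniform PPT adversary $\mathcal A$ that corrupts $S_{sp}$, receives $(M,\mathcal{VK},R)$, and sends, instead of the prescribed $\alpha$, a bit string computed in any way from its input, its coins and the first message of the prover. Here non-uniform PPT means a family of Boolean circuits of polynomial size with polynomially many uniform coins, and computational indistinguishability is against all distinguishers of this kind. -/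

import Mathlib

namespace FedPoP

noncomputable section

/-! ## Binary encodings -/

/-- Bit strings of length `n`. -/
abbrev Bits (n : ℕ) : Type := Fin n → Bool

/-- An injective encoding of the elements of `α` as Boolean vectors of one fixed shape. -/
class BitEnc (α : Type) where
  idx : Type
  bits : α → idx → Bool
  bits_injective : Function.Injective bits

instance : BitEnc Bool where
  idx := Unit
  bits b _ := b
  bits_injective _ _ h := congrFun h ()

instance {n : ℕ} {α : Type} [BitEnc α] : BitEnc (Fin n → α) where
  idx := Fin n × BitEnc.idx α
  bits v p := BitEnc.bits (v p.1) p.2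
  bits_injective _ _ h :=
    funext fun i => BitEnc.bits_injective (funext fun k => congrFun h (i, k))

instance {α β : Type} [BitEnc α] [BitEnc β] : BitEnc (α × β) where
  idx := BitEnc.idx α ⊕ BitEnc.idx β
  bits x := Sum.elim (BitEnc.bits x.1) (BitEnc.bits x.2)
  bits_injective _ _ h :=
    Prod.ext (BitEnc.bits_injective (funext fun i => congrFun h (Sum.inl i)))
      (BitEnc.bits_injective (funext fun i => congrFun h (Sum.inr i)))

/-- A flag, followed by the encoded value, or by zeros if there is none. -/
instance {α : Type} [BitEnc α] : BitEnc (Option α) where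
  idx := Option (BitEnc.idx α)
  bits x
    | none => x.isSome
    | some i => x.elim false fun a => BitEnc.bits a i
  bits_injective x y h := by
    cases x with
    | none =>
      cases y with
      | none => rfl
      | some b => simpa using congrFun h none
    | some a =>
      cases y with
      | none => simpa using congrFun h none
      | some b =>
        exact congrArg some (BitEnc.bits_injective (funext fun i => congrFun h (some i)))

/-- A set of parties, by its indicator vector. -/
instance {n : ℕ} : BitEnc (Finset (Fin n)) where
  idx := Fin n
  bits s i := decide (i ∈ s)
  bits_injective s t h := by
    ext i
    simpa using congrFun h i

/-- A residue modulo `q`, by the binary digits of its representative in `{0, …, q - 1}`. -/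
instance {q : ℕ} [NeZero q] : BitEnc (ZMod q) where
  idx := Fin (Nat.size q)
  bits x i := x.val.testBit i
  bits_injective x y h := by
    apply ZMod.val_injective q
    apply Nat.eq_of_testBit_eq
    intro i
    by_cases hi : i < Nat.size q
    · exact congrFun h ⟨i, hi⟩
    · have hq : q < 2 ^ i :=
        lt_of_lt_of_le (Nat.lt_size_self q) (Nat.pow_le_pow_right (by norm_num) (not_lt.mp hi))
      rw [Nat.testBit_lt_two_pow ((ZMod.val_lt x).trans hq),
        Nat.testBit_lt_two_pow ((ZMod.val_lt y).trans hq)]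

/-! ## Boolean circuits and non-uniform polynomial time -/

/-- A source for the input of a gate in a circuit with inputs `ι` and `s` earlier gates. -/
inductive Wire (ι : Type) (s : ℕ) : Type
  | input (i : ι)
  | const (b : Bool)
  | gate (k : Fin s)

/-- Boolean circuits with inputs `ι` and `s` NAND gates of unbounded fan-out, listed in
topological order. -/
inductive Circuit (ι : Type) : ℕ → Type
  | nil : Circuit ι 0
  | snoc {s : ℕ} (c : Circuit ι s) (a b : Wire ι s) : Circuit ι (s + 1)

/-- The value on a wire, given the inputs and the values of the gates. -/
def Wire.eval {ι : Type} {s : ℕ} (x : ι → Bool) (v : Fin s → Bool) : Wire ι s → Bool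
  | .input i => x i
  | .const b => b
  | .gate k => v k

/-- The values of all gates of a circuit. -/
def Circuit.eval {ι : Type} (x : ι → Bool) : {s : ℕ} → Circuit ι s → Fin s → Bool
  | _, .nil => Fin.elim0
  | _, .snoc c a b =>
    Fin.snoc (α := fun _ => Bool) (c.eval x) (!(a.eval x (c.eval x) && b.eval x (c.eval x)))

/-- `f` is computed, on encodings, by a Boolean circuit with at most `s` gates. -/
def HasCircuit {α β : Type} [BitEnc α] [BitEnc β] (f : α → β) (s : ℕ) : Prop :=
  ∃ (g : ℕ) (c : Circuit (BitEnc.idx α) g) (out : BitEnc.idx β → Wire (BitEnc.idx α) g),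
    g ≤ s ∧ ∀ (a : α) (i : BitEnc.idx β),
      (out i).eval (BitEnc.bits a) (c.eval (BitEnc.bits a)) = BitEnc.bits (f a) i

/-- A quantity is at most polynomial in the security parameter. -/
def PolyBounded (f : ℕ → ℕ) : Prop :=
  ∃ p : Polynomial ℕ, ∀ κ, f κ ≤ p.eval κ

/-- A family of functions, indexed by the security parameter, with circuits of polynomial size. -/
def PolySize {α β : ℕ → Type} [∀ κ, BitEnc (α κ)] [∀ κ, BitEnc (β κ)]
    (f : ∀ κ, α κ → β κ) : Prop :=
  ∃ p : Polynomial ℕ, ∀ κ, HasCircuit (f κ) (p.eval κ)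

/-! ## Probability -/

/-- The uniform distribution on bit strings of length `r`: the coins of a probabilistic party. -/
def coinFlips (r : ℕ) : PMF (Bits r) := PMF.uniformOfFintype (Bits r)

/-- Independent samples, one from each of the given distributions. -/
def indep {α : Type} : {n : ℕ} → (Fin n → PMF α) → PMF (Fin n → α)
  | 0, _ => PMF.pure Fin.elim0
  | _ + 1, p => do
    let a ← p 0
    let v ← indep fun i => p i.succ
    pure (Fin.cons a v)

/-- The difference of the probabilities that two experiments output `true`. -/
def gap (p q : PMF Bool) : ℝ := |(p true).toReal - (q true).toReal|

/-- Negligible: smaller than the inverse of every polynomial, eventually. -/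
def Negligible (f : ℕ → ℝ) : Prop :=
  Asymptotics.SuperpolynomialDecay Filter.atTop (fun κ : ℕ => (κ : ℝ)) f

/-- Computational indistinguishability: every non-uniform probabilistic polynomial-time
distinguisher (a family of Boolean circuits of polynomial size with polynomially many coins) has
negligible advantage. -/
def CompIndist {α : ℕ → Type} [∀ κ, BitEnc (α κ)] (X Y : ∀ κ, PMF (α κ)) : Prop :=
  ∀ (r : ℕ → ℕ) (D : ∀ κ, α κ × Bits (r κ) → Bool), PolyBounded r → PolySize D →
    Negligible fun κ =>
      gap (do let x ← X κ; let c ← coinFlips (r κ); pure (D κ (x, c)))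
        (do let y ← Y κ; let c ← coinFlips (r κ); pure (D κ (y, c)))

/-! ## Threshold signatures -/

/-- The algorithms of a `(t, n)`-threshold signature scheme. -/
structure ThresholdScheme where
  n : ℕ
  t : ℕ
  msgLen : ℕ
  vkLen : ℕ
  sigLen : ℕ
  /-- individual verification keys, individual signing keys, and partial signatures -/
  IVK : Type
  SK : Type
  PSig : Type
  /-- the global verification key, and the two individual keys of each signer -/
  keyGen : PMF (Bits vkLen × (Fin n → IVK × SK))
  sign : Bits msgLen → SK → PMF PSig
  /-- aggregation of the partial signatures that are present, by signer -/
  signAgg : (Fin n → Option PSig) → Bits vkLen → PMF (Bits sigLen)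
  verify : Bits sigLen → Bits msgLen → Bits vkLen → Bool

namespace ThresholdScheme

/-- The signature on `m` aggregated from partial signatures of exactly the signers in `S`. -/
def groupSign (T : ThresholdScheme) (vk : Bits T.vkLen) (keys : Fin T.n → T.IVK × T.SK)
    (m : Bits T.msgLen) (S : Finset (Fin T.n)) : PMF (Bits T.sigLen) := do
  let ps ← indep fun i =>
    if i ∈ S then some <$> T.sign m (keys i).2 else (pure none : PMF (Option T.PSig))
  T.signAgg ps vk

/-- An adversary against signer indistinguishability. It tosses `coins` coins, receives the global
verification key, and makes `queries + 1` adaptive queries `(m, S, S')`. The query with number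
`chal` is the challenge `(m, S₀, S₁)`; the others ask for a signature on `m` by `S`. -/
structure Adversary (T : ThresholdScheme) where
  coins : ℕ
  queries : ℕ
  chal : Fin (queries + 1)
  next : ∀ j : ℕ, Bits coins × Bits T.vkLen × (Fin j → Option (Bits T.sigLen)) →
    Bits T.msgLen × Finset (Fin T.n) × Finset (Fin T.n)
  guess : Bits coins × Bits T.vkLen × (Fin (queries + 1) → Option (Bits T.sigLen)) → Bool

/-- The answer to query number `j` when the hidden bit is `b`. Only authorized sets, of size `t`,
are served. -/
def answer (T : ThresholdScheme) (A : T.Adversary) (b : Bool) (vk : Bits T.vkLen)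
    (keys : Fin T.n → T.IVK × T.SK) (j : ℕ)
    (query : Bits T.msgLen × Finset (Fin T.n) × Finset (Fin T.n)) :
    PMF (Option (Bits T.sigLen)) :=
  if j = A.chal then
    if query.2.1.card = T.t ∧ query.2.2.card = T.t then
      some <$> T.groupSign vk keys query.1 (if b then query.2.2 else query.2.1)
    else pure none
  else
    if query.2.1.card = T.t then some <$> T.groupSign vk keys query.1 query.2.1 else pure none

/-- The first `j` answers that the adversary receives. -/
def answers (T : ThresholdScheme) (A : T.Adversary) (b : Bool) (vk : Bits T.vkLen)
    (keys : Fin T.n → T.IVK × T.SK) (c : Bits A.coins) :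
    (j : ℕ) → PMF (Fin j → Option (Bits T.sigLen))
  | 0 => pure Fin.elim0
  | j + 1 => do
    let h ← answers T A b vk keys c j
    let a ← T.answer A b vk keys j (A.next j (c, vk, h))
    pure (Fin.snoc (α := fun _ => Option (Bits T.sigLen)) h a)

/-- The signer-indistinguishability game with hidden bit `b`; its output is the final guess. -/
def game (T : ThresholdScheme) (A : T.Adversary) (b : Bool) : PMF Bool := do
  let (vk, keys) ← T.keyGen
  let c ← coinFlips A.coins
  let h ← T.answers A b vk keys c (A.queries + 1)
  pure (A.guess (c, vk, h))

/-- Non-uniform probabilistic polynomial time for adversaries of the game. -/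
def Adversary.IsPoly {T : ℕ → ThresholdScheme} (A : ∀ κ, (T κ).Adversary) : Prop :=
  (PolyBounded fun κ => (A κ).coins) ∧ (PolyBounded fun κ => (A κ).queries) ∧
    (∃ p : Polynomial ℕ, ∀ κ, ∀ j ≤ (A κ).queries, HasCircuit ((A κ).next j) (p.eval κ)) ∧
    PolySize fun κ => (A κ).guess

/-- The signatures do not reveal which authorized set of signers produced them. -/
def SignerIndistinguishable (T : ℕ → ThresholdScheme) : Prop :=
  ∀ A : ∀ κ, (T κ).Adversary, Adversary.IsPoly A →
    Negligible fun κ => gap ((T κ).game (A κ) true) ((T κ).game (A κ) false)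

end ThresholdScheme

/-! ## The protocol -/

/-- The algorithms of a secure aggregation protocol for `n` clients whose aggregated models are bit
strings of length `msgLen`: the setup, which gives every client and the server their key material,
the masking of a local model, and the aggregation of the masked models that have arrived. -/
structure SecureAggregation (n msgLen : ℕ) where
  ClientKey : Type
  ServerKey : Type
  Local : Type
  Masked : Type
  setup : PMF ((Fin n → ClientKey) × ServerKey)
  protect : ClientKey → ServerKey → Local → PMF Masked
  aggregate : (Fin n → ClientKey) → ServerKey → (Fin n → Option Masked) → PMF (Bits msgLen)

/-- The primitives of an instance of the protocol, for one value of the security parameter. -/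
structure Instance where
  ts : ThresholdScheme
  sa : SecureAggregation ts.n ts.msgLen
  /-- private data sets of the clients, and model parameters sent out by the FL server -/
  Data : Type
  Params : Type
  train : Params → Data → PMF sa.Local
  /-- the parameters for the next round, from the current ones and the aggregated model -/
  nextParams : Params → Bits ts.msgLen → Params
  digestLen : ℕ
  hash : Bits ts.msgLen → Bits digestLen
  /-- the group of prime order `q`, with its encoding by bit strings -/
  q : ℕ
  q_prime : Fact q.Prime
  G : Type
  group : CommGroup G
  card_G : Nat.card G = q
  elemLen : ℕ
  enc : G → Bits elemLen
  enc_injective : Function.Injective enc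
  prfLen : ℕ
  hash₁ : Bits ts.vkLen → G
  hash₂ : Bits ts.vkLen × G → Bits prfLen

attribute [instance] Instance.q_prime Instance.group

instance (P : Instance) : BitEnc P.G where
  idx := Fin P.elemLen
  bits := P.enc
  bits_injective := P.enc_injective

namespace Instance

/-- Exponentiation in the group. -/
def power (P : Instance) (x : P.G × ZMod P.q) : P.G := x.1 ^ x.2.val

/-- The membership test `a ∈ G`, together with the element that is encoded. -/
def decode (P : Instance) (a : Bits P.elemLen) : Option P.G :=
  open Classical in if h : ∃ g, P.enc g = a then some h.choose else none

/-- The pseudorandom function `F_K(x) = H₂(x, H₁(x) ^ K)`. -/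
def prf (P : Instance) (K : ZMod P.q) (x : Bits P.ts.vkLen) : Bits P.prfLen :=
  P.hash₂ (x, P.power (P.hash₁ x, K))

/-- What the clients bring to the rounds of the training: their data in each round, and the set of
clients that are online in each round; and the initial parameters of the FL server. -/
structure Training (P : Instance) where
  init : P.Params
  data : ℕ → Fin P.ts.n → P.Data
  online : ℕ → Finset (Fin P.ts.n)

/-- Securely aggregated training in round `l`, with a fresh setup: the global model. -/
def aggregateRound (P : Instance) (τ : P.Training) (l : ℕ) (pp : P.Params) :
    PMF (Bits P.ts.msgLen) := do
  let (ck, sk) ← P.sa.setup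
  let masked ← indep fun i =>
    if i ∈ τ.online l then
      (do
        let m ← P.train pp (τ.data l i)
        let c ← P.sa.protect (ck i) sk m
        pure (some c))
    else (pure none : PMF (Option P.sa.Masked))
  P.sa.aggregate ck sk masked

/-- The model parameters at the beginning of round `l`. -/
def paramsAt (P : Instance) (τ : P.Training) : ℕ → PMF P.Params
  | 0 => pure τ.init
  | l + 1 => do
    let pp ← P.paramsAt τ l
    let M ← P.aggregateRound τ l pp
    pure (P.nextParams pp M)

/-- What a client stores at the end of a round: the model, the proof of participation, and the
group witness. -/
structure ClientRecord (P : Instance) where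
  model : Bits P.ts.msgLen
  sig : Bits P.ts.sigLen
  key : ZMod P.q

/-- What the FL server sends to the service provider at the end of a round. -/
structure Token (P : Instance) where
  model : Bits P.ts.msgLen
  vk : Bits P.ts.vkLen
  prfValue : Bits P.prfLen

/-- The setup and generate phases of round `l`, where `S` is the set of clients whose partial
signatures the FL server aggregates. The clients that have dropped out receive nothing. -/
def generate (P : Instance) (τ : P.Training) (l : ℕ) (S : Finset (Fin P.ts.n)) :
    PMF (P.Token × (Fin P.ts.n → Option P.ClientRecord)) := do
  let (vk, keys) ← P.ts.keyGen
  let pp ← P.paramsAt τ l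
  let M ← P.aggregateRound τ l pp
  let σ ← P.ts.groupSign vk keys M S
  let K ← PMF.uniformOfFintype (ZMod P.q)
  pure (⟨M, vk, P.prf K vk⟩, fun i => if i ∈ τ.online l then some ⟨M, σ, K⟩ else none)

/-- The first message of the prover. -/
def firstMessage (P : Instance) (c : P.ClientRecord) : Bits P.digestLen := P.hash c.model

/-- The second message `(σ, β)` of the prover in response to `α`, if `α` is in the group. -/
def secondMessage (P : Instance) (c : P.ClientRecord) (a : Bits P.elemLen) :
    Option (Bits P.ts.sigLen × P.G) :=
  (P.decode a).map fun α => (c.sig, P.power (α, c.key))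

/-- The view of the service provider: its input, its coins, and the messages from the prover
(`none` for a message that is not sent). -/
structure View (P : Instance) (Coins : Type) where
  input : P.Token
  coins : Coins
  digest : Option (Bits P.digestLen)
  reply : Option (Bits P.ts.sigLen × P.G)

instance (P : Instance) : BitEnc P.Token where
  idx := BitEnc.idx (Bits P.ts.msgLen × Bits P.ts.vkLen × Bits P.prfLen)
  bits k := BitEnc.bits (k.model, k.vk, k.prfValue)
  bits_injective x y h := by
    have e := BitEnc.bits_injective h
    cases x
    cases y
    simpa using e

instance (P : Instance) (Coins : Type) [BitEnc Coins] : BitEnc (P.View Coins) where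
  idx := BitEnc.idx
    (P.Token × Coins × Option (Bits P.digestLen) × Option (Bits P.ts.sigLen × P.G))
  bits v := BitEnc.bits (v.input, v.coins, v.digest, v.reply)
  bits_injective x y h := by
    have e := BitEnc.bits_injective h
    cases x
    cases y
    simpa using e

/-- Round `l` with prover `i`: the view and the output of an honest-but-curious service provider.
It provides its service with the model `held M`, where `M` is the model of the round. -/
def honestView (P : Instance) (τ : P.Training) (l : ℕ) (held : Bits P.ts.msgLen → Bits P.ts.msgLen)
    (S : Finset (Fin P.ts.n)) (i : Fin P.ts.n) : PMF (P.View (ZMod P.q) × Bool) := do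
  let (token, record) ← P.generate τ l S
  let ρ ← PMF.uniformOfFintype (ZMod P.q)ˣ
  let input : P.Token := { token with model := held token.model }
  match record i with
  | none => pure (⟨input, ρ, none, none⟩, false)
  | some c =>
    let h := P.firstMessage c
    if h = P.hash input.model then
      let α := P.power (P.hash₁ input.vk, (ρ : ZMod P.q))
      let reply := P.secondMessage c (P.enc α)
      let output := reply.elim false fun r =>
        P.ts.verify r.1 input.model input.vk &&
          decide (P.hash₂ (input.vk, P.power (r.2, (ρ : ZMod P.q)⁻¹)) = input.prfValue)
      pure (⟨input, ρ, some h, reply⟩, output)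
    else pure (⟨input, ρ, some h, none⟩, false)

/-- A strategy of a corrupted service provider: from its input, its coins and the first message of
the prover it computes its own message `α`, an arbitrary bit string. -/
structure CorruptProvider (P : Instance) where
  coins : ℕ
  message : P.Token × Bits coins × Option (Bits P.digestLen) → Bits P.elemLen

/-- Round `l` with prover `i`: the view of a corrupted service provider. -/
def corruptView (P : Instance) (τ : P.Training) (l : ℕ) (A : P.CorruptProvider)
    (S : Finset (Fin P.ts.n)) (i : Fin P.ts.n) : PMF (P.View (Bits A.coins)) := do
  let (token, record) ← P.generate τ l S
  let c ← coinFlips A.coins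
  let digest := (record i).map P.firstMessage
  let a := A.message (token, c, digest)
  pure ⟨token, c, digest, (record i).bind fun r => P.secondMessage r a⟩

/-- The lengths of all strings are polynomial in the security parameter, and so are the circuits for
the public deterministic computations of the prove phase. -/
structure Efficient (P : ℕ → Instance) : Prop where
  n : PolyBounded fun κ => (P κ).ts.n
  msgLen : PolyBounded fun κ => (P κ).ts.msgLen
  vkLen : PolyBounded fun κ => (P κ).ts.vkLen
  sigLen : PolyBounded fun κ => (P κ).ts.sigLen
  digestLen : PolyBounded fun κ => (P κ).digestLen
  elemLen : PolyBounded fun κ => (P κ).elemLen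
  prfLen : PolyBounded fun κ => (P κ).prfLen
  q : PolyBounded fun κ => Nat.size (P κ).q
  hash : PolySize fun κ => (P κ).hash
  hash₁ : PolySize fun κ => (P κ).hash₁
  hash₂ : PolySize fun κ => (P κ).hash₂
  power : PolySize fun κ => (P κ).power
  decode : PolySize fun κ => (P κ).decode
  verify : PolySize fun κ (x : Bits (P κ).ts.sigLen × Bits (P κ).ts.msgLen × Bits (P κ).ts.vkLen) =>
    (P κ).ts.verify x.1 x.2.1 x.2.2

end Instance

end

end FedPoP

/-! All clients online in a round store the same record: the model `M`, the signature `σ` and the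
key `K`. The prover's messages are computed from this record, so replacing `C₀` by `C₁` changes
nothing at all. The signer set enters only through `σ`.

Apart from `vk` and `σ`, all randomness (`M`, `K`, the coins of the provider and of the
distinguisher) is independent of the signature keys, so it can be drawn first (`generate_bind`). The
view then becomes a function of `(vk, σ)` with the other choices as parameters (`honestView_bind`,
`corruptView_bind`). By averaging, some fixed choice of these parameters keeps at least the total
advantage (`exists_gap_bind_le`). Circuits are non-uniform, so this choice is hard-wired: neither
training, nor secure aggregation, nor `held` has to be simulated efficiently.

What remains is a polynomial-size test of `(vk, σ)`, that is, an adversary whose only query is the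
challenge `(M, S₀, S₁)`. Its circuit evaluates `prf`, answers `α` with `α ^ K` and runs the
distinguisher. In the honest case `power_power_inv` shows that the provider's check of `R` always
succeeds, so its output reduces to signature verification. -/

namespace FedPoP

/-! ## Circuit combinators -/

/-- Reroute the inputs of a wire to wires of a circuit with `s` gates, which is put in front. -/
def Wire.subst {ι κ : Type} {s g : ℕ} (w : κ → Wire ι s) : Wire κ g → Wire ι (s + g)
  | .input k =>
    match w k with
    | .input i => .input i
    | .const b => .const b
    | .gate j => .gate (Fin.castAdd g j)
  | .const b => .const b
  | .gate j => .gate (Fin.natAdd s j)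

/-- Two circuits in sequence: the inputs of the second one are wires of the first one. -/
def Circuit.subst {ι κ : Type} {s : ℕ} (c : Circuit ι s) (w : κ → Wire ι s) :
    {g : ℕ} → Circuit κ g → Circuit ι (s + g)
  | _, .nil => c
  | _, .snoc d a b => .snoc (c.subst w d) (a.subst w) (b.subst w)

theorem Wire.eval_subst {ι κ : Type} {s g : ℕ} (w : κ → Wire ι s) (x : ι → Bool)
    (v : Fin s → Bool) (u : Fin g → Bool) (a : Wire κ g) :
    (a.subst w).eval x (Fin.append v u) = a.eval (fun k => (w k).eval x v) u := by
  cases a with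
  | input k =>
    cases h : w k <;> simp [Wire.subst, Wire.eval, h]
  | const b => rfl
  | gate j => simp [Wire.subst, Wire.eval]

/-- The gates of `c` stay in front and never read later ones, so their values persist and the
induction only tracks the appended gates. -/
theorem Circuit.eval_subst {ι κ : Type} {s : ℕ} (c : Circuit ι s) (w : κ → Wire ι s)
    (x : ι → Bool) {g : ℕ} (d : Circuit κ g) :
    (c.subst w d).eval x =
      Fin.append (c.eval x) (d.eval fun k => (w k).eval x (c.eval x)) := by
  induction d with
  | nil =>
    funext i
    simp only [Circuit.subst]
    exact (Fin.append_left (c.eval x) _ i).symm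
  | snoc d a b ih =>
    simp only [Circuit.subst, Circuit.eval, ih, Wire.eval_subst, Fin.append_snoc]

/-- On the inputs `e a`, a circuit with at most `s` gates computes the outputs `f a`. -/
def Computes {A ι κ : Type} (e : A → ι → Bool) (f : A → κ → Bool) (s : ℕ) : Prop :=
  ∃ (g : ℕ) (c : Circuit ι g) (out : κ → Wire ι g),
    g ≤ s ∧ ∀ a i, (out i).eval (e a) (c.eval (e a)) = f a i

namespace Computes

variable {A B ι κ μ : Type} {e : A → ι → Bool} {s s' : ℕ}

theorem mono {f : A → κ → Bool} (h : Computes e f s) (hs : s ≤ s') : Computes e f s' := by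
  obtain ⟨g, c, out, hg, hc⟩ := h
  exact ⟨g, c, out, hg.trans hs, hc⟩

/-- Every output is an input or a constant. -/
theorem of_wires {f : A → κ → Bool} (out : κ → Wire ι 0)
    (h : ∀ a k, (out k).eval (e a) Fin.elim0 = f a k) : Computes e f 0 :=
  ⟨0, .nil, out, le_rfl, h⟩

/-- The second circuit is only known to be correct on vectors of the form `e' b`; `hφ` ensures that
it sees no others. -/
theorem comp {f : A → κ → Bool} {e' : B → κ → Bool} {f' : B → μ → Bool} {φ : A → B}
    (h' : Computes e' f' s') (h : Computes e f s) (hφ : ∀ a, e' (φ a) = f a) :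
    Computes e (fun a => f' (φ a)) (s + s') := by
  obtain ⟨g, c, out, hg, hc⟩ := h
  obtain ⟨g', c', out', hg', hc'⟩ := h'
  refine ⟨g + g', c.subst out c', fun i => (out' i).subst out, Nat.add_le_add hg hg', ?_⟩
  intro a i
  have hout : (fun k => (out k).eval (e a) (c.eval (e a))) = e' (φ a) := by
    rw [hφ]
    exact funext (hc a)
  rw [Circuit.eval_subst, Wire.eval_subst, hout, hc']

theorem sumElim {f : A → κ → Bool} {f' : A → μ → Bool} (h : Computes e f s)
    (h' : Computes e f' s') : Computes e (fun a => Sum.elim (f a) (f' a)) (s + s') := by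
  obtain ⟨g, c, out, hg, hc⟩ := h
  obtain ⟨g', c', out', hg', hc'⟩ := h'
  -- Substituting `Wire.input` lets the second circuit read the original inputs, so the two circuits
  -- stand side by side.
  refine ⟨g + g', c.subst Wire.input c',
    Sum.elim (fun k => (Wire.input k : Wire κ g').subst out) (fun k => (out' k).subst Wire.input),
    Nat.add_le_add hg hg', ?_⟩
  rintro a (k | k)
  · simp only [Sum.elim_inl, Circuit.eval_subst, Wire.eval_subst]
    exact hc a k
  · simp only [Sum.elim_inr, Circuit.eval_subst, Wire.eval_subst]
    exact hc' a k

/-- Outputs may be rearranged, repeated and dropped. -/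
theorem reindex {f : A → κ → Bool} (h : Computes e f s) (r : μ → κ) :
    Computes e (fun a k => f a (r k)) s := by
  obtain ⟨g, c, out, hg, hc⟩ := h
  exact ⟨g, c, out ∘ r, hg, fun a k => hc a (r k)⟩

/-- One circuit per output bit, side by side; hence the factor `Fintype.card κ`. -/
theorem pi [Fintype κ] {f : A → κ → Bool}
    (h : ∀ k, Computes e (fun a (_ : Unit) => f a k) s) :
    Computes e f (Fintype.card κ * s) := by
  classical
  -- Setting the bits outside `t` to `false` keeps the output type fixed during the induction.
  suffices H : ∀ t : Finset κ, Computes e (fun a k => if k ∈ t then f a k else false)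
      (t.card * s) by
    simpa using H Finset.univ
  intro t
  induction t using Finset.induction_on with
  | empty => exact (of_wires (fun _ => .const false) fun _ _ => rfl).mono (Nat.zero_le _)
  | insert j t hj ih =>
    have := (ih.sumElim (h j)).reindex fun k => if k = j then Sum.inr () else Sum.inl k
    rw [Finset.card_insert_of_notMem hj, add_one_mul]
    convert this using 3 with a k
    by_cases hk : k = j
    · subst hk
      simp
    · simp [hk]

/-- A NAND gate followed by a NAND of its value with itself, hence two extra gates. -/
theorem and {f : A → κ → Bool} (h : Computes e f s) (i j : κ) :
    Computes e (fun a (_ : Unit) => f a i && f a j) (s + 2) := by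
  obtain ⟨g, c, out, hg, hc⟩ := h
  let w : Wire κ 1 := .gate 0
  let d : Circuit κ 2 := (Circuit.nil.snoc (.input i) (.input j)).snoc w w
  have hd : Computes (id : (κ → Bool) → κ → Bool) (fun y (_ : Unit) => y i && y j) 2 := by
    refine ⟨2, d, fun _ => .gate (Fin.last 1), le_rfl, fun y _ => ?_⟩
    simp only [d, w, Wire.eval, Circuit.eval, Fin.snoc_last]
    have : (0 : Fin 1) = Fin.last 0 := rfl
    rw [this, Fin.snoc_last]
    simp
  exact hd.comp (φ := f) ⟨g, c, out, hg, hc⟩ fun _ => rfl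

end Computes

/-! ## Functions with small circuits -/

section HasCircuit

variable {α β γ : Type} [BitEnc α] [BitEnc β] [BitEnc γ] {s s' : ℕ}

theorem HasCircuit.comp {g : β → γ} {f : α → β} (hg : HasCircuit g s') (hf : HasCircuit f s) :
    HasCircuit (fun a => g (f a)) (s + s') :=
  Computes.comp (φ := f) hg hf fun _ => rfl

theorem HasCircuit.pair {f : α → β} {g : α → γ} (hf : HasCircuit f s) (hg : HasCircuit g s') :
    HasCircuit (fun a => (f a, g a)) (s + s') :=
  Computes.sumElim hf hg

theorem HasCircuit.some {f : α → β} (hf : HasCircuit f s) :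
    HasCircuit (fun a => Option.some (f a)) s := by
  obtain ⟨g, c, out, hg, hc⟩ := hf
  refine ⟨g, c, fun o => o.elim (.const true) out, hg, ?_⟩
  rintro a (_ | i)
  · rfl
  · exact hc a i

/-- Apply a function to an optional value: the circuit is run on the encoded value, or on zeros,
and the flag is then conjoined with all output bits. -/
theorem HasCircuit.optionMap [Fintype (BitEnc.idx γ)] {f : α × β → γ} (hf : HasCircuit f s) :
    HasCircuit (fun x : α × Option β => x.2.map fun b => f (x.1, b))
      (s + Fintype.card (Option (BitEnc.idx γ)) * 2) := by
  obtain ⟨g, c, out, hg, hc⟩ := hf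
  let e : α × Option β → BitEnc.idx (α × Option β) → Bool := BitEnc.bits
  -- The circuit as a function of raw bit vectors: zeros in place of a missing value need not encode
  -- an element of `β`, and `hc` says nothing about them.
  let F : (BitEnc.idx (α × β) → Bool) → BitEnc.idx γ → Bool := fun y i => (out i).eval y (c.eval y)
  let y : α × Option β → BitEnc.idx (α × β) → Bool := fun x =>
    Sum.elim (BitEnc.bits x.1) fun i => BitEnc.bits x.2 (Option.some i)
  have hF : Computes id F s := ⟨g, c, out, hg, fun _ _ => rfl⟩
  have hy : Computes e y 0 := Computes.of_wires
    (fun k => .input (Sum.elim Sum.inl (fun i => Sum.inr (Option.some i)) k)) (by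
      rintro a (k | k) <;> rfl)
  have hflag : Computes e (fun x (_ : Unit) => BitEnc.bits x.2 none) 0 :=
    Computes.of_wires (fun _ => .input (Sum.inr none)) fun _ _ => rfl
  have h₁ := (hF.comp (φ := y) hy fun _ => rfl).sumElim hflag
  -- Conjunction with the flag erases the arbitrary output on zeros; the flag is conjoined with
  -- itself.
  have h₂ : Computes (id : (BitEnc.idx γ ⊕ Unit → Bool) → _)
      (fun z (o : Option (BitEnc.idx γ)) => z (o.elim (Sum.inr ()) Sum.inl) && z (Sum.inr ()))
      (Fintype.card (Option (BitEnc.idx γ)) * 2) :=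
    Computes.pi fun o => ((Computes.of_wires Wire.input fun _ _ => rfl).and
      (o.elim (Sum.inr ()) Sum.inl) (Sum.inr ())).mono (by simp)
  have h₃ := h₂.comp (φ := fun x => Sum.elim (F (y x)) fun _ => BitEnc.bits x.2 none) h₁
    fun _ => rfl
  obtain ⟨g', c', out', hg', hc'⟩ := h₃
  refine ⟨g', c', out', by simpa using hg', fun x o => (hc' x o).trans ?_⟩
  obtain ⟨a, _ | b⟩ := x
  · cases o
    · rfl
    · exact Bool.and_false _
  · cases o with
    | none => rfl
    | some i => exact (Bool.and_true _).trans (hc (a, b) i)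

end HasCircuit

/-! ## Families of functions with circuits of polynomial size -/

section PolySize

variable {α β γ : ℕ → Type} [∀ κ, BitEnc (α κ)] [∀ κ, BitEnc (β κ)] [∀ κ, BitEnc (γ κ)]

theorem PolySize.comp {g : ∀ κ, β κ → γ κ} {f : ∀ κ, α κ → β κ} (hg : PolySize g)
    (hf : PolySize f) : PolySize fun κ a => g κ (f κ a) := by
  obtain ⟨p, hp⟩ := hg
  obtain ⟨p', hp'⟩ := hf
  exact ⟨p' + p, fun κ => by simpa using (hp κ).comp (hp' κ)⟩

theorem PolySize.pair {f : ∀ κ, α κ → β κ} {g : ∀ κ, α κ → γ κ} (hf : PolySize f)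
    (hg : PolySize g) : PolySize fun κ a => (f κ a, g κ a) := by
  obtain ⟨p, hp⟩ := hf
  obtain ⟨p', hp'⟩ := hg
  exact ⟨p + p', fun κ => by simpa using (hp κ).pair (hp' κ)⟩

theorem PolySize.some {f : ∀ κ, α κ → β κ} (hf : PolySize f) :
    PolySize fun κ a => Option.some (f κ a) := by
  obtain ⟨p, hp⟩ := hf
  exact ⟨p, fun κ => (hp κ).some⟩

theorem PolySize.optionMap [∀ κ, Fintype (BitEnc.idx (γ κ))] {f : ∀ κ, α κ × β κ → γ κ}
    (hf : PolySize f) (hγ : PolyBounded fun κ => Fintype.card (BitEnc.idx (γ κ))) :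
    PolySize fun κ (x : α κ × Option (β κ)) => x.2.map fun b => f κ (x.1, b) := by
  obtain ⟨p, hp⟩ := hf
  obtain ⟨p', hp'⟩ := hγ
  -- Two gates for each output bit and for the flag.
  refine ⟨p + (p' + 1) * 2, fun κ => Computes.mono (hp κ).optionMap ?_⟩
  have : Fintype.card (BitEnc.idx (γ κ)) ≤ p'.eval κ := hp' κ
  simp only [Fintype.card_option, Polynomial.eval_add, Polynomial.eval_mul, Polynomial.eval_one,
    Polynomial.eval_ofNat]
  omega

/-- Functions whose output bits are input bits and constants. -/
theorem PolySize.of_wires {f : ∀ κ, α κ → β κ}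
    (out : ∀ κ, BitEnc.idx (β κ) → Wire (BitEnc.idx (α κ)) 0)
    (h : ∀ κ a i, (out κ i).eval (BitEnc.bits a) Fin.elim0 = BitEnc.bits (f κ a) i) :
    PolySize f :=
  ⟨0, fun κ => Computes.mono (Computes.of_wires (out κ) (h κ)) (Nat.zero_le _)⟩

/-- Non-uniformity enters here: `b` is an arbitrary sequence, and hard-wiring it costs no gates. -/
theorem PolySize.const (b : ∀ κ, β κ) : PolySize fun κ (_ : α κ) => b κ :=
  .of_wires (fun κ i => .const (BitEnc.bits (b κ) i)) fun _ _ _ => rfl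

theorem PolySize.id : PolySize fun κ (a : α κ) => a :=
  .of_wires (fun _ i => .input i) fun _ _ _ => rfl

theorem PolySize.fst : PolySize fun κ (x : α κ × β κ) => x.1 :=
  .of_wires (fun _ i => .input (Sum.inl i)) fun _ _ _ => rfl

theorem PolySize.snd : PolySize fun κ (x : α κ × β κ) => x.2 :=
  .of_wires (fun _ i => .input (Sum.inr i)) fun _ _ _ => rfl

/-- The entry of a vector at a fixed position, with zeros in place of a missing value. -/
theorem PolySize.getD_apply {n m : ℕ → ℕ} (j : ∀ κ, Fin (m κ)) :
    PolySize fun κ (h : Fin (m κ) → Option (Bits (n κ))) => (h (j κ)).getD fun _ => false :=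
  .of_wires (fun κ i => .input (j κ, Option.some i)) fun κ h i => by
    change BitEnc.bits (h (j κ)) (Option.some i) = _
    cases h (j κ) <;> rfl

end PolySize

/-! ### Monad notation for probability mass functions -/

theorem pmf_bind_eq {α β : Type} (p : PMF α) (f : α → PMF β) : (p >>= f) = p.bind f := rfl

theorem pmf_pure_eq {α : Type} (a : α) : (pure a : PMF α) = PMF.pure a := rfl

theorem pmf_map_bind {α β γ : Type} (g : α → β) (p : PMF α) (f : β → PMF γ) :
    (g <$> p).bind f = p.bind fun a => f (g a) :=
  PMF.bind_map p g f

/-! ## Averaging -/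

theorem gap_comm (p q : PMF Bool) : gap p q = gap q p := abs_sub_comm _ _

theorem toReal_bind_apply {α β : Type} [Fintype α] (X : PMF α) (f : α → PMF β) (b : β) :
    ((X.bind f) b).toReal = ∑ x, (X x).toReal * (f x b).toReal := by
  rw [PMF.bind_apply, tsum_fintype, ENNReal.toReal_sum]
  · simp only [ENNReal.toReal_mul]
  · exact fun x _ => ENNReal.mul_ne_top (X.apply_ne_top x) ((f x).apply_ne_top b)

/-- The advantage in a mixture of experiments is attained by one of them. -/
theorem exists_gap_bind_le {α : Type} [Finite α] (X : PMF α) (f g : α → PMF Bool) :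
    ∃ x, gap (X.bind f) (X.bind g) ≤ gap (f x) (g x) := by
  have := Fintype.ofFinite α
  have : Nonempty α := X.support_nonempty.to_type
  -- The largest gap dominates the weighted average of all gaps.
  obtain ⟨x₀, hx₀⟩ := Finite.exists_max fun x => gap (f x) (g x)
  refine ⟨x₀, ?_⟩
  have hX : ∑ x, (X x).toReal = 1 := by
    rw [← ENNReal.toReal_sum fun x _ => X.apply_ne_top x, ← tsum_fintype (L := .unconditional _),
      X.tsum_coe, ENNReal.toReal_one]
  calc gap (X.bind f) (X.bind g)
      = |∑ x, (X x).toReal * ((f x true).toReal - (g x true).toReal)| := by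
        simp only [gap, toReal_bind_apply, mul_sub, Finset.sum_sub_distrib]
    _ ≤ ∑ x, (X x).toReal * gap (f x) (g x) := by
        refine (Finset.abs_sum_le_sum_abs _ _).trans_eq (Finset.sum_congr rfl fun x _ => ?_)
        rw [abs_mul, abs_of_nonneg ENNReal.toReal_nonneg, gap]
    _ ≤ ∑ x, (X x).toReal * gap (f x₀) (g x₀) :=
        Finset.sum_le_sum fun x _ => mul_le_mul_of_nonneg_left (hx₀ x) ENNReal.toReal_nonneg
    _ = gap (f x₀) (g x₀) := by rw [← Finset.sum_mul, hX, one_mul]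

theorem Negligible.of_gap_le {f : ℕ → ℝ} (hf : Negligible f) {p q : ℕ → PMF Bool}
    (h : ∀ κ, gap (p κ) (q κ) ≤ f κ) : Negligible fun κ => gap (p κ) (q κ) := by
  refine Asymptotics.SuperpolynomialDecay.trans_eventually_abs_le hf
    (Filter.Eventually.of_forall fun κ => ?_)
  have h0 : 0 ≤ gap (p κ) (q κ) := abs_nonneg _
  simp only [Function.comp_apply, abs_of_nonneg h0]
  exact (h κ).trans (le_abs_self _)

/-! ## Signer indistinguishability for a single non-adaptive query -/

namespace ThresholdScheme

/-- The experiment in which a test is applied to the global verification key and to a signature on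
`m` aggregated from the signers in `S`. -/
noncomputable def single (T : ThresholdScheme) (m : Bits T.msgLen) (S : Finset (Fin T.n))
    (D : Bits T.vkLen × Bits T.sigLen → Bool) : PMF Bool :=
  T.keyGen.bind fun k => (T.groupSign k.1 k.2 m S).bind fun σ => PMF.pure (D (k.1, σ))

/-- The adversary that asks the challenge `(m, S₀, S₁)` only, and applies `D` to the answer. -/
def singleQuery (T : ThresholdScheme) (m : Bits T.msgLen) (S₀ S₁ : Finset (Fin T.n))
    (D : Bits T.vkLen × Bits T.sigLen → Bool) : T.Adversary where
  coins := 0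
  queries := 0
  chal := 0
  next _ _ := (m, S₀, S₁)
  guess x := D (x.2.1, (x.2.2 0).getD fun _ => false)

/-- Both sets are authorized, so the challenge is answered and the default value in `guess` never
occurs. -/
theorem game_singleQuery (T : ThresholdScheme) (m : Bits T.msgLen) (S₀ S₁ : Finset (Fin T.n))
    (D : Bits T.vkLen × Bits T.sigLen → Bool) (h₀ : S₀.card = T.t) (h₁ : S₁.card = T.t)
    (b : Bool) :
    T.game (T.singleQuery m S₀ S₁ D) b = T.single m (if b then S₁ else S₀) D := by
  unfold game single
  congr 1
  funext k
  simp only [answers, answer, singleQuery, h₀, h₁, pmf_bind_eq, pmf_pure_eq, PMF.bind_bind,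
    PMF.pure_bind, pmf_map_bind, Fin.val_zero, if_true, and_self, PMF.bind_const]
  rfl

/-- The only query is a constant, so `next` needs no gates, and the guess costs no more than a
circuit for `D`. -/
theorem SignerIndistinguishable.single_negligible {T : ℕ → ThresholdScheme}
    (hT : SignerIndistinguishable T) (m : ∀ κ, Bits (T κ).msgLen)
    {S₀ S₁ : ∀ κ, Finset (Fin (T κ).n)} (h₀ : ∀ κ, (S₀ κ).card = (T κ).t)
    (h₁ : ∀ κ, (S₁ κ).card = (T κ).t) {D : ∀ κ, Bits (T κ).vkLen × Bits (T κ).sigLen → Bool}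
    (hD : PolySize D) :
    Negligible fun κ => gap ((T κ).single (m κ) (S₀ κ) (D κ)) ((T κ).single (m κ) (S₁ κ) (D κ)) := by
  have h := hT (fun κ => (T κ).singleQuery (m κ) (S₀ κ) (S₁ κ) (D κ)) ⟨⟨0, fun κ => Nat.zero_le _⟩,
    ⟨0, fun κ => Nat.zero_le _⟩, ⟨0, fun κ j _ =>
      ⟨0, .nil, fun i => .const (BitEnc.bits (m κ, S₀ κ, S₁ κ) i), Nat.zero_le _,
        fun _ _ => rfl⟩⟩, ?_⟩
  · simp only [game_singleQuery _ _ _ _ _ (h₀ _) (h₁ _)] at h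
    -- The game with bit `true` signs with `S₁`, which is the opposite order.
    simp only [gap_comm ((T _).single (m _) (S₀ _) (D _))]
    exact h
  · exact hD.comp ((PolySize.fst.comp PolySize.snd).pair
      ((PolySize.getD_apply fun _ => 0).comp (PolySize.snd.comp PolySize.snd)))

/-- The same for messages and tests that depend on an independent random variable. -/
theorem SignerIndistinguishable.bind_single_negligible {T : ℕ → ThresholdScheme}
    (hT : SignerIndistinguishable T) {Ω : ℕ → Type} [∀ κ, Finite (Ω κ)] (X : ∀ κ, PMF (Ω κ))
    (m : ∀ κ, Ω κ → Bits (T κ).msgLen)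
    {S₀ S₁ : ∀ κ, Finset (Fin (T κ).n)} (h₀ : ∀ κ, (S₀ κ).card = (T κ).t)
    (h₁ : ∀ κ, (S₁ κ).card = (T κ).t)
    {D : ∀ κ, Ω κ → Bits (T κ).vkLen × Bits (T κ).sigLen → Bool}
    (hD : ∀ ω : ∀ κ, Ω κ, PolySize fun κ => D κ (ω κ)) :
    Negligible fun κ => gap ((X κ).bind fun ω => (T κ).single (m κ ω) (S₀ κ) (D κ ω))
      ((X κ).bind fun ω => (T κ).single (m κ ω) (S₁ κ) (D κ ω)) := by
  -- The best outcome for each `κ` is non-uniform advice. `hD` covers every such sequence.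
  choose ω hω using fun κ => exists_gap_bind_le (X κ)
    (fun ω => (T κ).single (m κ ω) (S₀ κ) (D κ ω)) (fun ω => (T κ).single (m κ ω) (S₁ κ) (D κ ω))
  exact (hT.single_negligible (fun κ => m κ (ω κ)) h₀ h₁ (hD ω)).of_gap_le hω

end ThresholdScheme

/-! ### Reordering the random choices of a round; unblinding -/

namespace Instance

/-- The model of round `l`. -/
noncomputable def modelAt (P : Instance) (τ : P.Training) (l : ℕ) : PMF (Bits P.ts.msgLen) :=
  (P.paramsAt τ l).bind (P.aggregateRound τ l)

/-- What is independent of the keys in an execution of a round: the model, the key of the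
pseudorandom function, and the coins of the parties. -/
noncomputable def side (P : Instance) (τ : P.Training) (l : ℕ) {Γ : Type} (c : PMF Γ) :
    PMF (Bits P.ts.msgLen × ZMod P.q × Γ) :=
  (P.modelAt τ l).bind fun M => (PMF.uniformOfFintype (ZMod P.q)).bind fun K =>
    c.bind fun x => PMF.pure (M, K, x)

/-- The keys of the signature scheme may be generated after all other random choices. -/
theorem generate_bind (P : Instance) (τ : P.Training) (l : ℕ) (S : Finset (Fin P.ts.n))
    {Γ : Type} (c : PMF Γ) (f : P.Token × (Fin P.ts.n → Option P.ClientRecord) → Γ → Bool) :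
    ((P.generate τ l S).bind fun x => c.bind fun y => PMF.pure (f x y)) =
      (P.side τ l c).bind fun ω => P.ts.single ω.1 S fun x =>
        f (⟨ω.1, x.1, P.prf ω.2.1 x.1⟩, fun i =>
          if i ∈ τ.online l then some ⟨ω.1, x.2, ω.2.1⟩ else none) ω.2.2 := by
  simp only [generate, side, modelAt, ThresholdScheme.single, pmf_bind_eq,
    pmf_pure_eq, PMF.bind_bind, PMF.pure_bind]
  rw [PMF.bind_comm]
  refine congrArg _ (funext fun pp => ?_)
  rw [PMF.bind_comm]
  refine congrArg _ (funext fun M => ?_)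
  -- `K` moves ahead of both key generation and signing.
  simp only [PMF.bind_comm _ (PMF.uniformOfFintype (ZMod P.q))]
  refine congrArg _ (funext fun K => ?_)
  simp only [PMF.bind_comm _ c]

theorem decode_enc (P : Instance) (a : P.G) : P.decode (P.enc a) = some a := by
  have h : ∃ g, P.enc g = P.enc a := ⟨a, rfl⟩
  rw [decode, dif_pos h, P.enc_injective h.choose_spec]

/-- The order of `a` divides `q`, so exponents count only modulo `q`, where `ρ` and `ρ⁻¹` cancel. -/
theorem power_power_inv (P : Instance) (a : P.G) (K : ZMod P.q) (ρ : (ZMod P.q)ˣ) :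
    P.power (P.power (P.power (a, (ρ : ZMod P.q)), K), (ρ : ZMod P.q)⁻¹) = P.power (a, K) := by
  simp only [power, ← pow_mul]
  rw [pow_eq_pow_iff_modEq]
  have ho : orderOf a ∣ P.q := P.card_G ▸ orderOf_dvd_natCard a
  refine Nat.ModEq.of_dvd ho ?_
  rw [← ZMod.natCast_eq_natCast_iff]
  push_cast
  simp only [ZMod.natCast_zmod_val]
  field_simp

end Instance
theorem PolyBounded.add {f g : ℕ → ℕ} (hf : PolyBounded f) (hg : PolyBounded g) :
    PolyBounded fun κ => f κ + g κ := by
  obtain ⟨p, hp⟩ := hf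
  obtain ⟨p', hp'⟩ := hg
  exact ⟨p + p', fun κ => by simpa using Nat.add_le_add (hp κ) (hp' κ)⟩

/-- A choice between two families of functions that depends on the security parameter only. -/
theorem PolySize.ite {α β : ℕ → Type} [∀ κ, BitEnc (α κ)] [∀ κ, BitEnc (β κ)]
    {f g : ∀ κ, α κ → β κ} (c : ℕ → Prop) [DecidablePred c] (hf : PolySize f) (hg : PolySize g) :
    PolySize fun κ a => if c κ then f κ a else g κ a := by
  obtain ⟨p, hp⟩ := hf
  obtain ⟨p', hp'⟩ := hg
  refine ⟨p + p', fun κ => ?_⟩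
  rw [Polynomial.eval_add]
  by_cases h : c κ
  · simp only [h, if_true]
    exact Computes.mono (hp κ) (Nat.le_add_right _ _)
  · simp only [h, if_false]
    exact Computes.mono (hp' κ) (Nat.le_add_left _ _)

/-! ### The views as functions of the verification key and the signature -/

namespace Instance

/-- The view and the output of an honest service provider that holds `M'`, in terms of the digest
from the prover and the random choices. -/
def honestResult (P : Instance) (M' : Bits P.ts.msgLen) (h : Bits P.digestLen) (K : ZMod P.q)
    (ρ : ZMod P.q) (x : Bits P.ts.vkLen × Bits P.ts.sigLen) : P.View (ZMod P.q) × Bool :=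
  if h = P.hash M' then
    (⟨⟨M', x.1, P.prf K x.1⟩, ρ, some h, some (x.2, P.power (P.power (P.hash₁ x.1, ρ), K))⟩,
      P.ts.verify x.2 M' x.1)
  else (⟨⟨M', x.1, P.prf K x.1⟩, ρ, some h, none⟩, false)

/-- The right-hand side does not mention `i`: this is the independence of the prover. The check of
`R` has disappeared by `power_power_inv`. -/
theorem honestView_bind (P : Instance) (τ : P.Training) (l : ℕ)
    (held : Bits P.ts.msgLen → Bits P.ts.msgLen) (S : Finset (Fin P.ts.n)) (i : Fin P.ts.n)
    (hi : i ∈ τ.online l) {r : ℕ} (D : (P.View (ZMod P.q) × Bool) × Bits r → Bool) :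
    ((P.honestView τ l held S i).bind fun v =>
        (coinFlips r).bind fun c => PMF.pure (D (v, c))) =
      (P.side τ l ((PMF.uniformOfFintype (ZMod P.q)ˣ).bind fun ρ =>
        (coinFlips r).bind fun c => PMF.pure (ρ, c))).bind fun ω =>
          P.ts.single ω.1 S fun x =>
            D (P.honestResult (held ω.1) (P.hash ω.1) ω.2.1 ω.2.2.1 x, ω.2.2.2) := by
  -- The deterministic part of `honestView`, once the round and `ρ` are fixed.
  let R (x : P.Token × (Fin P.ts.n → Option P.ClientRecord)) (ρ : (ZMod P.q)ˣ) :
      P.View (ZMod P.q) × Bool :=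
    let input : P.Token := { x.1 with model := held x.1.model }
    match x.2 i with
    | none => (⟨input, ρ, none, none⟩, false)
    | some c =>
      let h := P.firstMessage c
      if h = P.hash input.model then
        let α := P.power (P.hash₁ input.vk, (ρ : ZMod P.q))
        let reply := P.secondMessage c (P.enc α)
        let output := reply.elim false fun r =>
          P.ts.verify r.1 input.model input.vk &&
            decide (P.hash₂ (input.vk, P.power (r.2, (ρ : ZMod P.q)⁻¹)) = input.prfValue)
        (⟨input, ρ, some h, reply⟩, output)
      else (⟨input, ρ, some h, none⟩, false)
  have hR : P.honestView τ l held S i = (P.generate τ l S).bind fun x =>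
      (PMF.uniformOfFintype (ZMod P.q)ˣ).bind fun ρ => PMF.pure (R x ρ) := by
    unfold honestView
    simp only [pmf_bind_eq, pmf_pure_eq]
    refine congrArg _ (funext fun x => congrArg _ (funext fun ρ => ?_))
    simp only [R]
    cases x.2 i with
    | none => rfl
    | some c => exact (apply_ite PMF.pure _ _ _).symm
  have := P.generate_bind τ l S ((PMF.uniformOfFintype (ZMod P.q)ˣ).bind fun ρ =>
    (coinFlips r).bind fun c => PMF.pure (ρ, c)) fun x y => D (R x y.1, y.2)
  simp only [hR, PMF.bind_bind, PMF.pure_bind] at this ⊢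
  rw [this]
  refine congrArg _ (funext fun ω => congrArg _ (funext fun x => ?_))
  congr 2
  simp only [R, hi, if_true, honestResult, firstMessage, secondMessage, decode_enc,
    Option.map_some, Option.elim_some, power_power_inv, prf, decide_true, Bool.and_true]

/-- The view of a corrupted service provider, in terms of the random choices. -/
noncomputable def corruptResult (P : Instance) (A : P.CorruptProvider) (M : Bits P.ts.msgLen) (K : ZMod P.q)
    (c : Bits A.coins) (x : Bits P.ts.vkLen × Bits P.ts.sigLen) : P.View (Bits A.coins) :=
  ⟨⟨M, x.1, P.prf K x.1⟩, c, some (P.hash M),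
    (P.decode (A.message (⟨M, x.1, P.prf K x.1⟩, c, some (P.hash M)))).map fun α =>
      (x.2, P.power (α, K))⟩

/-- Again `i` drops out. The membership test remains, since the provider's string need not encode a
group element. -/
theorem corruptView_bind (P : Instance) (τ : P.Training) (l : ℕ) (A : P.CorruptProvider)
    (S : Finset (Fin P.ts.n)) (i : Fin P.ts.n) (hi : i ∈ τ.online l) {r : ℕ}
    (D : P.View (Bits A.coins) × Bits r → Bool) :
    ((P.corruptView τ l A S i).bind fun v =>
        (coinFlips r).bind fun c => PMF.pure (D (v, c))) =
      (P.side τ l ((coinFlips A.coins).bind fun c =>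
        (coinFlips r).bind fun d => PMF.pure (c, d))).bind fun ω =>
          P.ts.single ω.1 S fun x =>
            D (P.corruptResult A ω.1 ω.2.1 ω.2.2.1 x, ω.2.2.2) := by
  have := P.generate_bind τ l S ((coinFlips A.coins).bind fun c =>
    (coinFlips r).bind fun d => PMF.pure (c, d)) fun x y =>
      D (⟨x.1, y.1, (x.2 i).map P.firstMessage, (x.2 i).bind fun r =>
        P.secondMessage r (A.message (x.1, y.1, (x.2 i).map P.firstMessage))⟩, y.2)
  simp only [corruptView, pmf_bind_eq, pmf_pure_eq, PMF.bind_bind, PMF.pure_bind] at this ⊢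
  rw [this]
  refine congrArg _ (funext fun ω => congrArg _ (funext fun x => ?_))
  simp only [hi, if_true, Option.map_some, Option.bind_some, firstMessage, secondMessage,
    corruptResult]

/-! ### Circuits for the views -/

section PolySize

variable {P : ℕ → Instance} {α : ℕ → Type} [∀ κ, BitEnc (α κ)]

/-- The encoding of a token is by definition that of the triple of its fields. -/
theorem polySize_token {M : ∀ κ, α κ → Bits (P κ).ts.msgLen} {v : ∀ κ, α κ → Bits (P κ).ts.vkLen}
    {R : ∀ κ, α κ → Bits (P κ).prfLen} (hM : PolySize M) (hv : PolySize v) (hR : PolySize R) :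
    PolySize fun κ a => (⟨M κ a, v κ a, R κ a⟩ : (P κ).Token) :=
  hM.pair (hv.pair hR)

theorem polySize_view {Γ : ℕ → Type} [∀ κ, BitEnc (Γ κ)] {k : ∀ κ, α κ → (P κ).Token}
    {c : ∀ κ, α κ → Γ κ} {h : ∀ κ, α κ → Option (Bits (P κ).digestLen)}
    {m : ∀ κ, α κ → Option (Bits (P κ).ts.sigLen × (P κ).G)} (hk : PolySize k) (hc : PolySize c)
    (hh : PolySize h) (hm : PolySize m) :
    PolySize fun κ a => (⟨k κ a, c κ a, h κ a, m κ a⟩ : (P κ).View (Γ κ)) :=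
  hk.pair (hc.pair (hh.pair hm))

theorem Efficient.polySize_prf (hP : Efficient P) (K : ∀ κ, ZMod (P κ).q) :
    PolySize fun κ x => (P κ).prf (K κ) x :=
  hP.hash₂.comp (PolySize.id.pair (hP.power.comp (hP.hash₁.pair (PolySize.const K))))

theorem Efficient.polySize_honestResult (hP : Efficient P) (M : ∀ κ, Bits (P κ).ts.msgLen)
    (h : ∀ κ, Bits (P κ).digestLen) (K ρ : ∀ κ, ZMod (P κ).q) :
    PolySize fun κ => (P κ).honestResult (M κ) (h κ) (K κ) (ρ κ) := by
  have hk := polySize_token (P := P)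
    (α := fun κ => Bits (P κ).ts.vkLen × Bits (P κ).ts.sigLen) (PolySize.const M)
    PolySize.fst ((hP.polySize_prf K).comp PolySize.fst)
  have hβ := hP.power.comp ((hP.power.comp ((hP.hash₁.comp PolySize.fst).pair
    (PolySize.const ρ))).pair (PolySize.const K))
      (f := fun κ (x : Bits (P κ).ts.vkLen × Bits (P κ).ts.sigLen) => _)
  -- Both digests are fixed for each `κ`, so their comparison selects a circuit and is not part of
  -- it.
  exact PolySize.ite (fun κ => h κ = (P κ).hash (M κ))
    ((polySize_view hk (PolySize.const ρ) (PolySize.const fun κ => some (h κ))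
        (PolySize.some (PolySize.snd.pair hβ))).pair
      (hP.verify.comp (PolySize.snd.pair ((PolySize.const M).pair PolySize.fst))))
    ((polySize_view hk (PolySize.const ρ) (PolySize.const fun κ => some (h κ))
        (PolySize.const fun κ => none)).pair (PolySize.const fun κ => false))

theorem Efficient.polySize_corruptResult (hP : Efficient P) {A : ∀ κ, (P κ).CorruptProvider}
    (hA : PolySize fun κ => (A κ).message) (M : ∀ κ, Bits (P κ).ts.msgLen)
    (K : ∀ κ, ZMod (P κ).q) (c : ∀ κ, Bits (A κ).coins) :
    PolySize fun κ => (P κ).corruptResult (A κ) (M κ) (K κ) (c κ) := by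
  have hk := polySize_token (P := P)
    (α := fun κ => Bits (P κ).ts.vkLen × Bits (P κ).ts.sigLen) (PolySize.const M)
    PolySize.fst ((hP.polySize_prf K).comp PolySize.fst)
  have ha := hP.decode.comp (hA.comp (hk.pair ((PolySize.const c).pair
    (PolySize.const fun κ => some ((P κ).hash (M κ))))))
  let _ (κ : ℕ) : Fintype (BitEnc.idx (Bits (P κ).ts.sigLen × (P κ).G)) :=
    inferInstanceAs (Fintype ((Fin (P κ).ts.sigLen × Unit) ⊕ Fin (P κ).elemLen))
  have hcard : PolyBounded fun κ =>
      Fintype.card (BitEnc.idx (Bits (P κ).ts.sigLen × (P κ).G)) := by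
    convert hP.sigLen.add hP.elemLen using 2 with κ
    change Fintype.card ((Fin (P κ).ts.sigLen × Unit) ⊕ Fin (P κ).elemLen) = _
    simp
  have hβ : PolySize fun κ (y : Bits (P κ).ts.sigLen × (P κ).G) =>
      (y.1, (P κ).power (y.2, K κ)) :=
    PolySize.fst.pair (hP.power.comp (PolySize.snd.pair (PolySize.const K)))
  have hm : PolySize fun κ (x : Bits (P κ).ts.vkLen × Bits (P κ).ts.sigLen) =>
      ((P κ).decode ((A κ).message (⟨M κ, x.1, (P κ).prf (K κ) x.1⟩, c κ,
        some ((P κ).hash (M κ))))).map fun α => (x.2, (P κ).power (α, K κ)) :=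
    -- `σ` is carried along beside the optional `α`, and is released only if decoding succeeds.
    (hβ.optionMap hcard).comp (PolySize.snd.pair ha)
  exact polySize_view hk (PolySize.const c) (PolySize.const fun κ => some ((P κ).hash (M κ))) hm

end PolySize

end Instance

end FedPoP

/-! ### Anonymity -/

theorem mainTheorem3
    (P : ℕ → FedPoP.Instance) (hP : FedPoP.Instance.Efficient P)
    (hTS : FedPoP.ThresholdScheme.SignerIndistinguishable fun κ => (P κ).ts)
    (τ : ∀ κ, (P κ).Training)
    (l : ℕ → ℕ)
    (C₀ C₁ : ∀ κ, Fin (P κ).ts.n)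
    (hC₀ : ∀ κ, C₀ κ ∈ (τ κ).online (l κ)) (hC₁ : ∀ κ, C₁ κ ∈ (τ κ).online (l κ))
    (S₀ S₁ : ∀ κ, Finset (Fin (P κ).ts.n))
    (hS₀ : ∀ κ, S₀ κ ⊆ (τ κ).online (l κ)) (hS₁ : ∀ κ, S₁ κ ⊆ (τ κ).online (l κ))
    (hS₀_card : ∀ κ, (S₀ κ).card = (P κ).ts.t) (hS₁_card : ∀ κ, (S₁ κ).card = (P κ).ts.t) :
    (∀ held : ∀ κ, FedPoP.Bits (P κ).ts.msgLen → FedPoP.Bits (P κ).ts.msgLen,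
      FedPoP.CompIndist
        (fun κ => (P κ).honestView (τ κ) (l κ) (held κ) (S₀ κ) (C₀ κ))
        (fun κ => (P κ).honestView (τ κ) (l κ) (held κ) (S₁ κ) (C₁ κ))) ∧
    ∀ A : ∀ κ, (P κ).CorruptProvider,
      (FedPoP.PolyBounded fun κ => (A κ).coins) →
      (FedPoP.PolySize fun κ => (A κ).message) →
      FedPoP.CompIndist
        (fun κ => (P κ).corruptView (τ κ) (l κ) (A κ) (S₀ κ) (C₀ κ))
        (fun κ => (P κ).corruptView (τ κ) (l κ) (A κ) (S₁ κ) (C₁ κ)) := by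
  refine ⟨fun held r D _ hD => ?_, fun A _ hA r D _ hD => ?_⟩
  · have h := FedPoP.ThresholdScheme.SignerIndistinguishable.bind_single_negligible hTS
      -- The coins of the distinguisher join the side information, so that averaging fixes them too.
      (fun κ => (P κ).side (τ κ) (l κ) ((PMF.uniformOfFintype (ZMod (P κ).q)ˣ).bind fun ρ =>
        (FedPoP.coinFlips (r κ)).bind fun c => PMF.pure (ρ, c)))
      (fun κ ω => ω.1) hS₀_card hS₁_card
      (D := fun κ ω x => D κ ((P κ).honestResult (held κ ω.1) ((P κ).hash ω.1) ω.2.1 ω.2.2.1 x,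
        ω.2.2.2))
      fun ω => hD.comp ((hP.polySize_honestResult (fun κ => held κ (ω κ).1)
        (fun κ => (P κ).hash (ω κ).1) (fun κ => (ω κ).2.1) fun κ => (ω κ).2.2.1).pair
        (FedPoP.PolySize.const fun κ => (ω κ).2.2.2))
    exact h.of_gap_le fun κ => (congrArg₂ FedPoP.gap
      ((P κ).honestView_bind (τ κ) (l κ) (held κ) (S₀ κ) (C₀ κ) (hC₀ κ) (D κ))
      ((P κ).honestView_bind (τ κ) (l κ) (held κ) (S₁ κ) (C₁ κ) (hC₁ κ) (D κ))).le
  · have h := FedPoP.ThresholdScheme.SignerIndistinguishable.bind_single_negligible hTS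
      (fun κ => (P κ).side (τ κ) (l κ) ((FedPoP.coinFlips (A κ).coins).bind fun c =>
        (FedPoP.coinFlips (r κ)).bind fun d => PMF.pure (c, d)))
      (fun κ ω => ω.1) hS₀_card hS₁_card
      (D := fun κ ω x => D κ ((P κ).corruptResult (A κ) ω.1 ω.2.1 ω.2.2.1 x, ω.2.2.2))
      fun ω => hD.comp ((hP.polySize_corruptResult hA (fun κ => (ω κ).1) (fun κ => (ω κ).2.1)
        fun κ => (ω κ).2.2.1).pair (FedPoP.PolySize.const fun κ => (ω κ).2.2.2))
    exact h.of_gap_le fun κ => (congrArg₂ FedPoP.gap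
      ((P κ).corruptView_bind (τ κ) (l κ) (A κ) (S₀ κ) (C₀ κ) (hC₀ κ) (D κ))
      ((P κ).corruptView_bind (τ κ) (l κ) (A κ) (S₁ κ) (C₁ κ) (hC₁ κ) (D κ))).le
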